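/- Let $E$ be a real Banach space with dual $E^*$ and bidual $E^{**}$. Call $f\colon E\times E^*\to\,]-\infty,\infty]$ a *strongly representative function* if $f$ is proper, convex and (norm) lower semicontinuous, $f(x,x^*)\ge\langle x,x^*\rangle$ for all $(x,x^*)\in E\times E^*$, and $f^*(x^*,x^{**})\ge\langle x^*,x^{**}\rangle$ for all $(x^*,x^{**})\in E^*\times E^{**}$, where $f^*(x^*,x^{**})=\sup_{(y,y^*)\in E\times E^*}\big[\langle y,x^*\rangle+\langle y^*,x^{**}\rangle-f(y,y^*)\big]$. A multifunction $S\colon E\rightrightarrows E^*$ is *strongly representable* if there is a strongly representative function $f$ such that the graph of $S$ is $\{(x,x^*)\in E\times E^*\colon f(x,x^*)=\langle x,x^*\rangle\}$. Theorem 17. Every strongly representable multifunction $S\colon E\rightrightarrows E^*$ is strongly maximally monotone. That is, $S$ is monotone and the following two properties hold. (a) ($S$ is $w(E^*,E)$-cc maximally monotone.) Whenever $y\in E$ and $C$ is a nonempty $w(E^*,E)$-compact convex subset of $E^*$ such that for every $(s,s^*)$ in the graph of $S$ there exists $y^*\in C$ with $\langle s-y,s^*-y^*\rangle\ge0$, we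 have $Sy\cap C\neq\emptyset$. (b) ($S$ is $w(E,E^*)$-cc maximally monotone.) Whenever $C$ is a nonempty $w(E,E^*)$-compact convex subset of $E$ and $y^*\in E^*$ are such that for every $(s,s^*)$ in the graph of $S$ there exists $w\in C$ with $\langle s-w,s^*-y^*\rangle\ge0$, we have $S^{-1}y^*\cap C\neq\emptyset$. -/

import Mathlib

namespace StronglyRepresentable

section Functions

variable {X : Type*} [NormedAddCommGroup X] [NormedSpace ℝ X]

/-- `h : X → ]-∞, ∞]` is proper, convex and lower semicontinuous (for the norm topology).
The value `-∞` is excluded, so the sums in the convexity inequality are the usual ones. -/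
structure IsPCLSC (h : X → EReal) : Prop where
  ne_bot : ∀ x, h x ≠ ⊥
  exists_ne_top : ∃ x, h x ≠ ⊤
  convex : ∀ x y : X, ∀ a b : ℝ, 0 < a → 0 < b → a + b = 1 →
    h (a • x + b • y) ≤ (a : EReal) * h x + (b : EReal) * h y
  lsc : LowerSemicontinuous h

/-- The Fenchel conjugate `h*(z*) = sup_x [⟨x, z*⟩ - h x]`, a function on the dual of `X`. -/
noncomputable def fenchelConj (h : X → EReal) (z : StrongDual ℝ X) : EReal :=
  ⨆ x : X, ((z x : ℝ) : EReal) - h x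

end Functions

section Monotone

variable {E : Type*} [NormedAddCommGroup E] [NormedSpace ℝ E]

/-- The conjugate of `f : E × E* → ]-∞, ∞]` as a function on `E* × E**`: the pair `(x*, x**)` is
identified with the functional `(y, y*) ↦ ⟨y, x*⟩ + ⟨y*, x**⟩` on `E × E*`. -/
noncomputable def pairConj (f : E × StrongDual ℝ E → EReal)
    (xs : StrongDual ℝ E) (xss : StrongDual ℝ (StrongDual ℝ E)) : EReal :=
  fenchelConj f (xs.coprod xss)

/-- `f` is a representative function on `E × E*`. -/
structure IsRepresentative (f : E × StrongDual ℝ E → EReal) : Prop where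
  pclsc : IsPCLSC f
  pairing_le : ∀ (x : E) (xs : StrongDual ℝ E), ((xs x : ℝ) : EReal) ≤ f (x, xs)

/-- `f` is a strongly representative function on `E × E*`. -/
structure IsStronglyRepresentative (f : E × StrongDual ℝ E → EReal) : Prop where
  representative : IsRepresentative f
  pairing_le_conj : ∀ (xs : StrongDual ℝ E) (xss : StrongDual ℝ (StrongDual ℝ E)),
    ((xss xs : ℝ) : EReal) ≤ pairConj f xs xss

/-- The multifunction `E ⇉ E*` with graph `{(x, x*) : f (x, x*) = ⟨x, x*⟩}`. -/
def multifunctionOf (f : E × StrongDual ℝ E → EReal) : E → Set (StrongDual ℝ E) :=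
  fun x => {xs | f (x, xs) = ((xs x : ℝ) : EReal)}

/-- A multifunction `S : E ⇉ E*` is strongly representable. -/
def IsStronglyRepresentable (S : E → Set (StrongDual ℝ E)) : Prop :=
  ∃ f : E × StrongDual ℝ E → EReal, IsStronglyRepresentative f ∧ multifunctionOf f = S

/-- A multifunction `S : E ⇉ E*` is monotone. -/
def IsMonotone (S : E → Set (StrongDual ℝ E)) : Prop :=
  ∀ s t : E, ∀ ss ∈ S s, ∀ ts ∈ S t, 0 ≤ (ss - ts) (s - t)

/-- `S` is `w(E*, E)`-cc maximally monotone. -/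
def IsWeakStarCCMaximallyMonotone (S : E → Set (StrongDual ℝ E)) : Prop :=
  IsMonotone S ∧
    ∀ (y : E) (C : Set (StrongDual ℝ E)), C.Nonempty →
      IsCompact (StrongDual.toWeakDual '' C : Set (WeakDual ℝ E)) → Convex ℝ C →
      (∀ s : E, ∀ ss ∈ S s, ∃ ys ∈ C, 0 ≤ (ss - ys) (s - y)) →
      (S y ∩ C).Nonempty

/-- `S` is `w(E, E*)`-cc maximally monotone. -/
def IsWeakCCMaximallyMonotone (S : E → Set (StrongDual ℝ E)) : Prop :=
  IsMonotone S ∧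
    ∀ (C : Set E) (ys : StrongDual ℝ E), C.Nonempty →
      IsCompact (toWeakSpace ℝ E '' C : Set (WeakSpace ℝ E)) → Convex ℝ C →
      (∀ s : E, ∀ ss ∈ S s, ∃ w ∈ C, 0 ≤ (ss - ys) (s - w)) →
      ({x : E | ys ∈ S x} ∩ C).Nonempty

/-- `S` is strongly maximally monotone. -/
def IsStronglyMaximallyMonotone (S : E → Set (StrongDual ℝ E)) : Prop :=
  IsWeakStarCCMaximallyMonotone S ∧ IsWeakCCMaximallyMonotone S

end Monotone

end StronglyRepresentable

namespace StronglyRepresentable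

open Set Filter Topology

/-! Both halves are one statement about `Y` embedded isometrically in `X*`: for (a), `X = E` and `Y
= E*`; for (b), `X = E*` and `Y = E ⊆ E**`, with `f` transposed. In either case `C` is weak* compact
in `X*`.

Fenchel duality is applied to `f` plus a penalty made of the support function of `C` at `x₀ - x` and
half squared distances from `x` to `x₀` and from `y` to `C`. The bound on `f*` forces its infimum to
be at most `0`, which gives points where `f` is nearly the pairing (`exists_approx`). With `C` a
singleton, iteration turns near-equality into equality nearby, a Brøndsted–Rockafellar property
(`exists_eq_of_le`). The hypothesis on `C` then yields graph points arbitrarily close to `{x₀} × C`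
(`exists_mem_near`). A weak* cluster point in `C` is monotonically related to the whole graph, hence
lies on it by maximality (`exists_mem_eq`). -/

theorem exists_half_norm_sq_lt {X : Type*} [NormedAddCommGroup X] [NormedSpace ℝ X]
    (w : StrongDual ℝ X) {t : ℝ} (ht : t < ‖w‖ ^ 2 / 2) :
    ∃ z : X, t < -(w z + ‖z‖ ^ 2 / 2) := by
  by_contra! h
  have h0 : 0 ≤ t := by simpa using h 0
  have key : ‖w‖ ≤ √(2 * t) := by
    refine ContinuousLinearMap.opNorm_le_bound _ (Real.sqrt_nonneg _) fun z => ?_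
    have h2 : ∀ z, w z ≤ √(2 * t) * ‖z‖ := by
      intro z
      rcases eq_or_ne z 0 with rfl | hz
      · simp
      have hz' : 0 < ‖z‖ := norm_pos_iff.2 hz
      -- This multiple of `z` minimises `w + ‖·‖² / 2` on the line through `z`.
      have := h (-(w z / ‖z‖ ^ 2) • z)
      rw [norm_smul, map_smul, smul_eq_mul, norm_neg, mul_pow, Real.norm_eq_abs, sq_abs] at this
      have e : (w z / ‖z‖ ^ 2) ^ 2 * ‖z‖ ^ 2 = (w z) ^ 2 / ‖z‖ ^ 2 := by field_simp
      have e2 : -(w z / ‖z‖ ^ 2) * w z = -((w z) ^ 2 / ‖z‖ ^ 2) := by field_simp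
      rw [e, e2] at this
      have h3 : (w z) ^ 2 / ‖z‖ ^ 2 ≤ 2 * t := by linarith
      rw [div_le_iff₀ (by positivity)] at h3
      refine le_trans (Real.le_sqrt_of_sq_le h3) ?_
      rw [Real.sqrt_mul (by positivity), Real.sqrt_sq hz'.le]
    rw [Real.norm_eq_abs, abs_le]
    have h3 := h2 (-z)
    rw [map_neg, norm_neg] at h3
    exact ⟨by linarith, h2 z⟩
  have := Real.sq_sqrt (by positivity : 0 ≤ 2 * t)
  nlinarith [norm_nonneg w, Real.sqrt_nonneg (2 * t)]

/-- Compactness leaves finitely many `z` to consider; Sion's minimax theorem then merges them into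
one. -/
theorem exists_forall_lt_of_isCompact {E F : Type*}
    [TopologicalSpace E] [AddCommGroup E] [Module ℝ E]
    [IsTopologicalAddGroup E] [ContinuousSMul ℝ E]
    [TopologicalSpace F] [AddCommGroup F] [Module ℝ F]
    [IsTopologicalAddGroup F] [ContinuousSMul ℝ F] {K : Set E} (hne : K.Nonempty)
    (hK : IsCompact K) (hconv : Convex ℝ K) {g : E → F → ℝ}
    (h1 : ∀ z, Continuous fun c => g c z) (h2 : ∀ z, ConvexOn ℝ K fun c => g c z)
    (h3 : ∀ c, Continuous (g c)) (h4 : ∀ c, ConcaveOn ℝ univ (g c)) {t : ℝ}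
    (h : ∀ c ∈ K, ∃ z, t < g c z) : ∃ z, ∀ c ∈ K, t < g c z := by
  obtain ⟨s, hs⟩ : ∃ s : Finset F, ∀ c ∈ K, ∃ z ∈ s, t < g c z := by
    obtain ⟨s, hs⟩ := hK.elim_finite_subcover (fun z => {c | t < g c z})
      (fun z => isOpen_lt continuous_const (h1 z)) fun c hc => by simpa using h c hc
    exact ⟨s, fun c hc => by simpa using hs hc⟩
  obtain ⟨z, -, hz⟩ := Sion.exists_lt_iInf_of_lt_iInf_of_finite (X := K) (Y := univ) (f := g)
    hne hK (fun z _ => (h1 z).lowerSemicontinuous.lowerSemicontinuousOn _)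
    (fun z _ => (h2 z).quasiconvexOn) convex_univ
    (fun c _ => (h3 c).upperSemicontinuous.upperSemicontinuousOn _)
    (fun c _ => (h4 c).quasiconcaveOn) hconv s.finite_toSet (subset_univ _) hs
  exact ⟨z, hz⟩

theorem convexOn_half_norm_sq {X : Type*} [NormedAddCommGroup X] [NormedSpace ℝ X] :
    ConvexOn ℝ univ fun z : X => ‖z‖ ^ 2 / 2 := by
  have := ((convexOn_norm (E := X) convex_univ).pow (fun x _ => norm_nonneg x) 2).smul
    (by norm_num : (0 : ℝ) ≤ 1 / 2)
  refine this.congr fun z _ => ?_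
  simp [div_eq_inv_mul]

/-- For fixed `c`, the infimum over `z` of the left side is `-‖u - c‖² / 2`; minimax makes `z`
independent of `c`. -/
theorem exists_forall_le_neg_half_norm_sq {X : Type*} [NormedAddCommGroup X] [NormedSpace ℝ X]
    {K : Set (WeakDual ℝ X)} (hne : K.Nonempty) (hK : IsCompact K) (hconv : Convex ℝ K)
    (u : StrongDual ℝ X) {η : ℝ} (hη : 0 < η) :
    ∃ z : X, ∃ c₀ ∈ K, ∀ c ∈ K,
      u z - c z + ‖z‖ ^ 2 / 2 ≤ -(‖u - WeakDual.toStrongDual c₀‖ ^ 2 / 2) + η := by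
  set m := sInf ((fun c => ‖u - WeakDual.toStrongDual c‖ ^ 2 / 2) '' K) with hm
  have hb : BddBelow ((fun c => ‖u - WeakDual.toStrongDual c‖ ^ 2 / 2) '' K) :=
    ⟨0, by rintro _ ⟨c, -, rfl⟩; positivity⟩
  obtain ⟨_, ⟨c₀, hc₀, rfl⟩, hlt⟩ := exists_lt_of_csInf_lt (hne.image _)
    (show m < m + η / 2 by linarith)
  obtain ⟨z, hz⟩ := exists_forall_lt_of_isCompact (t := m - η / 2) hne hK hconv
    (g := fun (c : WeakDual ℝ X) (z : X) => -(u z - c z + ‖z‖ ^ 2 / 2))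
    (fun z => by
      have := WeakDual.eval_continuous (𝕜 := ℝ) z
      exact ((continuous_const.sub this).add continuous_const).neg)
    (fun z => by
      refine ⟨hconv, fun c _ d _ a b _ _ hab => le_of_eq ?_⟩
      change -(u z - (a * c z + b * d z) + ‖z‖ ^ 2 / 2) =
        a * -(u z - c z + ‖z‖ ^ 2 / 2) + b * -(u z - d z + ‖z‖ ^ 2 / 2)
      obtain rfl : a = 1 - b := by linarith
      ring)
    (fun c => by fun_prop)
    (fun c => by
      refine ConvexOn.neg (f := fun z => u z - c z + ‖z‖ ^ 2 / 2) ?_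
      exact ((u - WeakDual.toStrongDual c).toLinearMap.convexOn convex_univ).add
        convexOn_half_norm_sq)
    (fun c hc => by
      have : m ≤ _ := csInf_le hb ⟨c, hc, rfl⟩
      exact exists_half_norm_sq_lt (u - WeakDual.toStrongDual c) (by dsimp at this; linarith))
  exact ⟨z, c₀, hc₀, fun c hc => by have := hz c hc; dsimp at hlt; linarith⟩

/-! ### Fenchel duality by separation -/

section Sandwich

variable {Z : Type*} [NormedAddCommGroup Z] [NormedSpace ℝ Z]

theorem IsPCLSC.convex_coe {f : Z → EReal} (hf : IsPCLSC f) {x y : Z} {r s : ℝ}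
    (hx : f x ≤ r) (hy : f y ≤ s) {a b : ℝ} (ha : 0 < a) (hb : 0 < b) (hab : a + b = 1) :
    f (a • x + b • y) ≤ ((a * r + b * s : ℝ) : EReal) := by
  refine (hf.convex x y a b ha hb hab).trans ?_
  rw [EReal.coe_add, EReal.coe_mul, EReal.coe_mul]
  exact add_le_add (mul_le_mul_of_nonneg_left hx (EReal.coe_nonneg.2 ha.le))
    (mul_le_mul_of_nonneg_left hy (EReal.coe_nonneg.2 hb.le))

/-- A form of Fenchel duality: if `P ≤ f*` and, for every `u`, the infimum of `G (z, c) + u z` over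
all `z` and all `c ∈ C` is at most `P u`, then the infimum of `f z + G (z, c)` is at most `0`. -/
theorem exists_lt_of_le_fenchelConj {Y : Type*} [NormedAddCommGroup Y] [NormedSpace ℝ Y]
    {f : Z → EReal} (hf : IsPCLSC f) {G : Z × Y → ℝ} (hG : ConvexOn ℝ univ G)
    (hGc : Continuous G) {C : Set Y} (hC : Convex ℝ C) (hne : C.Nonempty)
    {P : StrongDual ℝ Z → ℝ} (hP : ∀ u, ((P u : ℝ) : EReal) ≤ fenchelConj f u)
    (hGP : ∀ u, ∀ η > 0, ∃ z, ∃ c ∈ C, G (z, c) + u z ≤ P u + η) {ε : ℝ} (hε : 0 < ε) :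
    ∃ z, ∃ c ∈ C, f z < ((ε - G (z, c) : ℝ) : EReal) := by
  by_contra! hcon
  -- If the conclusion fails, this open strict hypograph misses the epigraph `B` of `f`, so
  -- Hahn–Banach separates them.
  let A : Set (Z × ℝ) := {p | ∃ c ∈ C, p.2 < ε - G (p.1, c)}
  let B : Set (Z × ℝ) := {p | f p.1 ≤ (p.2 : EReal)}
  have hA : Convex ℝ A := by
    refine convex_iff_forall_pos.2 ?_
    rintro ⟨z, r⟩ ⟨c, hc, h⟩ ⟨w, s⟩ ⟨d, hd, h'⟩ a b ha hb hab
    refine ⟨a • c + b • d, hC hc hd ha.le hb.le hab, ?_⟩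
    have := hG.2 (mem_univ (z, c)) (mem_univ (w, d)) ha.le hb.le hab
    simp only [Prod.smul_mk, Prod.mk_add_mk, smul_eq_mul] at this h h' ⊢
    have h1 := mul_lt_mul_of_pos_left h ha
    have h2 := mul_lt_mul_of_pos_left h' hb
    have h3 : ε = a * ε + b * ε := by rw [← add_mul, hab, one_mul]
    linarith
  have hAo : IsOpen A := by
    have : A = ⋃ c ∈ C, {p : Z × ℝ | p.2 < ε - G (p.1, c)} := by ext; simp [A]
    rw [this]
    exact isOpen_biUnion fun c _ => isOpen_lt (by fun_prop) (by fun_prop)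
  have hB : Convex ℝ B := by
    refine convex_iff_forall_pos.2 ?_
    rintro ⟨z, r⟩ h ⟨w, s⟩ h' a b ha hb hab
    exact hf.convex_coe h h' ha hb hab
  have hAB : Disjoint A B := by
    refine disjoint_left.2 ?_
    rintro ⟨z, r⟩ ⟨c, hc, h⟩ h'
    exact absurd (EReal.coe_le_coe_iff.1 ((hcon z c hc).trans h')) (not_le.2 h)
  obtain ⟨φ, s, hφA, hφB⟩ := geometric_hahn_banach_open hA hAo hB hAB
  obtain ⟨c₀, hc₀⟩ := hne
  set κ := φ (0, 1) with hκ
  have hφ : ∀ z t, φ (z, t) = φ (z, 0) + t * κ := by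
    intro z t
    have : ((z, t) : Z × ℝ) = (z, 0) + t • (0, 1) := by simp
    rw [this, map_add, map_smul, smul_eq_mul]
  obtain ⟨z₀, hz₀⟩ := hf.exists_ne_top
  have hfin : ∀ z, f z ≠ ⊤ → f z = ((f z).toReal : EReal) := fun z hz =>
    (EReal.coe_toReal hz (hf.ne_bot z)).symm
  -- The hyperplane is not vertical: over `z₀`, where `f` is finite, `A` has a point strictly below
  -- one of `B`.
  have hκpos : 0 < κ := by
    have h1 := hφB (z₀, (f z₀).toReal) (hfin z₀ hz₀).le
    have h2 := hφA (z₀, ε - G (z₀, c₀) - 1) ⟨c₀, hc₀, by dsimp; linarith⟩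
    have h3 := hcon z₀ c₀ hc₀
    rw [hfin z₀ hz₀, EReal.coe_le_coe_iff] at h3
    rw [hφ] at h1 h2
    by_contra! hneg
    nlinarith
  let u : StrongDual ℝ Z := -(κ⁻¹ • φ.comp (ContinuousLinearMap.inl ℝ Z ℝ))
  have hu : ∀ z, φ (z, 0) = -(κ * u z) := by
    intro z
    simp [u, hκpos.ne']
  have hconj : fenchelConj f u ≤ ((-(s / κ) : ℝ) : EReal) := by
    refine iSup_le fun z => ?_
    by_cases hz : f z = ⊤
    · simp [hz]
    have h1 := hφB (z, (f z).toReal) (hfin z hz).le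
    rw [hfin z hz, ← EReal.coe_sub, EReal.coe_le_coe_iff]
    rw [hφ, hu] at h1
    have : s / κ ≤ (f z).toReal - u z := by
      rw [div_le_iff₀ hκpos]; linarith
    linarith
  have hPs : P u ≤ -(s / κ) := EReal.coe_le_coe_iff.1 ((hP u).trans hconj)
  obtain ⟨z, c, hc, hle⟩ := hGP u (ε / 4) (by positivity)
  have h2 := hφA (z, ε - G (z, c) - ε / 4) ⟨c, hc, by dsimp; linarith⟩
  rw [hφ, hu] at h2
  have : ε - G (z, c) - ε / 4 - u z < s / κ := by
    rw [lt_div_iff₀ hκpos]; linarith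
  linarith

end Sandwich

/-! ### Support functions of bounded sets -/

section Support

variable {X Y : Type*} [NormedAddCommGroup X] [NormedSpace ℝ X]
  [NormedAddCommGroup Y] [NormedSpace ℝ Y] (j : Y →ₗᵢ[ℝ] StrongDual ℝ X) {C : Set Y}

/-- The support function on `X` of a set `C ⊆ Y`, where `Y` is embedded into the dual of `X`. -/
noncomputable def supportFun (C : Set Y) (z : X) : ℝ := sSup ((fun c => j c z) '' C)

variable {j}

theorem le_mul_norm_of_mem {R : ℝ} (hR : ∀ c ∈ C, ‖c‖ ≤ R) {c : Y} (hc : c ∈ C) (z : X) :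
    j c z ≤ R * ‖z‖ := by
  refine (le_abs_self _).trans ?_
  refine ((j c).le_opNorm z).trans ?_
  rw [j.norm_map]
  exact mul_le_mul_of_nonneg_right (hR c hc) (norm_nonneg z)

theorem le_supportFun {R : ℝ} (hR : ∀ c ∈ C, ‖c‖ ≤ R) {c : Y} (hc : c ∈ C) (z : X) :
    j c z ≤ supportFun j C z :=
  le_csSup ⟨R * ‖z‖, by rintro _ ⟨c, hc, rfl⟩; exact le_mul_norm_of_mem hR hc z⟩ ⟨c, hc, rfl⟩

theorem supportFun_le (hne : C.Nonempty) {z : X} {r : ℝ} (h : ∀ c ∈ C, j c z ≤ r) :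
    supportFun j C z ≤ r :=
  csSup_le (hne.image _) (by rintro _ ⟨c, hc, rfl⟩; exact h c hc)

theorem supportFun_le_add (hne : C.Nonempty) {R : ℝ} (hR : ∀ c ∈ C, ‖c‖ ≤ R) (z w : X) :
    supportFun j C z ≤ supportFun j C w + R * ‖z - w‖ := by
  refine supportFun_le hne fun c hc => ?_
  have h1 := le_supportFun (j := j) hR hc w
  have h2 := le_mul_norm_of_mem (j := j) hR hc (z - w)
  rw [map_sub] at h2
  linarith

theorem continuous_supportFun (hne : C.Nonempty) {R : ℝ} (hR : ∀ c ∈ C, ‖c‖ ≤ R) :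
    Continuous (supportFun j C) := by
  refine (LipschitzWith.of_le_add_mul R.toNNReal fun z w => ?_).continuous
  obtain ⟨c, hc⟩ := hne
  rw [Real.coe_toNNReal R ((norm_nonneg c).trans (hR c hc)), dist_eq_norm]
  exact supportFun_le_add ⟨c, hc⟩ hR z w

theorem convexOn_supportFun (hne : C.Nonempty) {R : ℝ} (hR : ∀ c ∈ C, ‖c‖ ≤ R) :
    ConvexOn ℝ univ (supportFun j C) := by
  refine ⟨convex_univ, fun z _ w _ a b ha hb _ => supportFun_le hne fun c hc => ?_⟩
  rw [map_add, map_smul, map_smul]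
  exact add_le_add (mul_le_mul_of_nonneg_left (le_supportFun hR hc z) ha)
    (mul_le_mul_of_nonneg_left (le_supportFun hR hc w) hb)

theorem bounded_of_isCompact_toWeakDual [CompleteSpace X]
    (hC : IsCompact ((fun c => StrongDual.toWeakDual (j c)) '' C)) : ∃ R, ∀ c ∈ C, ‖c‖ ≤ R := by
  obtain ⟨R, hR⟩ := banach_steinhaus (g := fun c : C => j c) fun z => by
    obtain ⟨M, hM⟩ := (hC.image (WeakDual.eval_continuous (𝕜 := ℝ) z)).isBounded.exists_norm_le
    exact ⟨M, fun c => hM _ ⟨_, ⟨c, c.2, rfl⟩, rfl⟩⟩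
  exact ⟨R, fun c hc => by simpa using hR ⟨c, hc⟩⟩

end Support

/-! ### Approximation and maximality in the abstract setting -/

section Duality

variable {X Y : Type*} [NormedAddCommGroup X] [NormedSpace ℝ X]
  [NormedAddCommGroup Y] [NormedSpace ℝ Y]

/-- A common abstraction of strongly representative functions on `E × E*` and of their
transposes on `E* × E`: here `Y` is isometrically embedded by `j` into the dual of `X`, and `Q`
extends the pairing `⟨x, y⟩ = j y x` to `X* × Y*`. -/
structure IsDualRepresentative (j : Y →ₗᵢ[ℝ] StrongDual ℝ X)
    (Q : StrongDual ℝ X →L[ℝ] StrongDual ℝ Y →L[ℝ] ℝ) (f : X × Y → EReal) : Prop where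
  pclsc : IsPCLSC f
  pairing_le : ∀ x y, ((j y x : ℝ) : EReal) ≤ f (x, y)
  pairing_le_conj : ∀ u v, ((Q u v : ℝ) : EReal) ≤ fenchelConj f (u.coprod v)
  apply_left : ∀ c v, Q (j c) v = v c
  apply_right : ∀ u x, Q u ((ContinuousLinearMap.apply ℝ ℝ x).comp
    j.toContinuousLinearMap) = u x
  norm_le : ∀ u v, |Q u v| ≤ ‖u‖ * ‖v‖

variable {j : Y →ₗᵢ[ℝ] StrongDual ℝ X} {Q : StrongDual ℝ X →L[ℝ] StrongDual ℝ Y →L[ℝ] ℝ}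
  {f : X × Y → EReal} {C : Set Y}

namespace IsDualRepresentative

variable (hf : IsDualRepresentative j Q f)
include hf

theorem exists_lt (hne : C.Nonempty) (hconv : Convex ℝ C)
    (hK : IsCompact ((fun c => StrongDual.toWeakDual (j c)) '' C)) {R : ℝ}
    (hR : ∀ c ∈ C, ‖c‖ ≤ R) (x₀ : X) {ε : ℝ} (hε : 0 < ε) :
    ∃ x y, ∃ c ∈ C, f (x, y) < ((ε - (supportFun j C (x₀ - x) + ‖x - x₀‖ ^ 2 / 2 +
      ‖y - c‖ ^ 2 / 2 - j y x₀) : ℝ) : EReal) := by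
  let e : StrongDual ℝ Y := (ContinuousLinearMap.apply ℝ ℝ x₀).comp j.toContinuousLinearMap
  have he : ∀ y, e y = j y x₀ := fun y => rfl
  let G : (X × Y) × Y → ℝ := fun p => supportFun j C (x₀ - p.1.1) + ‖p.1.1 - x₀‖ ^ 2 / 2 +
      ‖p.1.2 - p.2‖ ^ 2 / 2 - e p.1.2
  have hGc : Continuous G := by
    have := continuous_supportFun (j := j) hne hR
    fun_prop
  have hG : ConvexOn ℝ univ G := by
    have hs := convexOn_supportFun (j := j) hne hR
    have hX := convexOn_half_norm_sq (X := X)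
    have hY := convexOn_half_norm_sq (X := Y)
    refine ⟨convex_univ, ?_⟩
    rintro ⟨⟨x, y⟩, c⟩ - ⟨⟨x', y'⟩, c'⟩ - a b ha hb hab
    have h1 := hs.2 (mem_univ (x₀ - x)) (mem_univ (x₀ - x')) ha hb hab
    have h2 := hX.2 (mem_univ (x - x₀)) (mem_univ (x' - x₀)) ha hb hab
    have h3 := hY.2 (mem_univ (y - c)) (mem_univ (y' - c')) ha hb hab
    have e0 : x₀ = a • x₀ + b • x₀ := by rw [← add_smul, hab, one_smul]
    have e1 : a • (x₀ - x) + b • (x₀ - x') = x₀ - (a • x + b • x') := by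
      conv_rhs => rw [e0]
      module
    have e2 : a • (x - x₀) + b • (x' - x₀) = a • x + b • x' - x₀ := by
      conv_rhs => rw [e0]
      module
    have e3 : a • (y - c) + b • (y' - c') = a • y + b • y' - (a • c + b • c') := by module
    rw [e1] at h1
    rw [e2] at h2
    rw [e3] at h3
    simp only [smul_eq_mul] at h1 h2 h3
    simp only [G, Prod.smul_mk, Prod.mk_add_mk, smul_eq_mul, map_add, map_smul]
    linarith
  obtain ⟨⟨x, y⟩, c, hc, h⟩ := exists_lt_of_le_fenchelConj hf.pclsc hG hGc hconv hne
    (P := fun w => Q (w.comp (ContinuousLinearMap.inl ℝ X Y))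
      (w.comp (ContinuousLinearMap.inr ℝ X Y)))
    (fun w => by
      have := hf.pairing_le_conj (w.comp (ContinuousLinearMap.inl ℝ X Y))
        (w.comp (ContinuousLinearMap.inr ℝ X Y))
      rwa [ContinuousLinearMap.coprod_comp_inl_inr] at this)
    (fun w η hη => by
      set u := w.comp (ContinuousLinearMap.inl ℝ X Y)
      set v := w.comp (ContinuousLinearMap.inr ℝ X Y)
      have hw : ∀ x y, w (x, y) = u x + v y := by
        intro x y
        change w (x, y) = w (x, 0) + w (0, y)
        rw [← map_add]
        simp
      obtain ⟨z, _, ⟨c, hc, rfl⟩, hz⟩ := exists_forall_le_neg_half_norm_sq (hne.image _) hK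
        (hconv.is_linear_image (f := fun c => StrongDual.toWeakDual (j c))
          ⟨fun a b => by simp, fun a b => by simp⟩) u (half_pos hη)
      have hz' : ∀ c' ∈ C, u z - j c' z + ‖z‖ ^ 2 / 2 ≤ -(‖u - j c‖ ^ 2 / 2) + η / 2 :=
        fun c' hc' => hz _ ⟨c', hc', rfl⟩
      obtain ⟨y, hy⟩ := exists_half_norm_sq_lt (v - e)
        (show ‖v - e‖ ^ 2 / 2 - η / 2 < ‖v - e‖ ^ 2 / 2 by linarith)
      refine ⟨(x₀ + z, c + y), c, hc, ?_⟩
      have hsup : supportFun j C (x₀ - (x₀ + z)) ≤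
          -(‖u - j c‖ ^ 2 / 2) + η / 2 - u z - ‖z‖ ^ 2 / 2 := by
        refine supportFun_le hne fun c' hc' => ?_
        have := hz' c' hc'
        rw [show x₀ - (x₀ + z) = -z by abel, map_neg]
        linarith
      -- The two half squares produced by minimising in `x` and in `y` dominate `-Q (u - j c) (v -
      -- e)`, which leaves at most `Q u v`.
      have hQ := (abs_le.1 (hf.norm_le (u - j c) (v - e))).1
      have hQ' : Q (u - j c) (v - e) = Q u v - u x₀ - v c + j c x₀ := by
        have h1 := hf.apply_right u x₀
        have h2 := hf.apply_left c v
        have h3 := hf.apply_left c e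
        rw [he] at h3
        simp only [map_sub, sub_apply]
        rw [h2, h3, show Q u e = u x₀ from h1]
        ring
      have hxz : x₀ + z - x₀ = z := by abel
      have hyc : c + y - c = y := by abel
      have hecy := he c
      rw [hw]
      simp only [G, hxz, hyc, map_add]
      simp only [sub_apply] at hy
      nlinarith [sq_nonneg (‖u - j c‖ - ‖v - e‖)])
    hε
  exact ⟨x, y, c, hc, h⟩

theorem exists_approx (hne : C.Nonempty) (hconv : Convex ℝ C)
    (hK : IsCompact ((fun c => StrongDual.toWeakDual (j c)) '' C)) {R : ℝ}
    (hR : ∀ c ∈ C, ‖c‖ ≤ R) (x₀ : X) {ε : ℝ} (hε : 0 < ε) :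
    ∃ x y, ∃ c ∈ C, f (x, y) ≤ ((j y x + ε : ℝ) : EReal) ∧
      supportFun j C (x₀ - x) + j y (x - x₀) + ‖x - x₀‖ ^ 2 / 2 + ‖y - c‖ ^ 2 / 2 < ε := by
  obtain ⟨x, y, c, hc, h⟩ := hf.exists_lt hne hconv hK hR x₀ hε
  refine ⟨x, y, c, hc, h.le.trans (EReal.coe_le_coe_iff.2 ?_), ?_⟩
  -- Bounding the support function below by its value at `c` leaves `j (y - c) (x - x₀)`, absorbed
  -- by the half squares.
  · have h1 := le_supportFun (j := j) hR hc (x₀ - x)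
    have h2 := (abs_le.1 ((j (y - c)).le_opNorm (x - x₀))).1
    rw [j.norm_map] at h2
    simp only [map_sub, sub_apply] at h1 h2
    nlinarith [sq_nonneg (‖x - x₀‖ - ‖y - c‖)]
  · have := EReal.coe_lt_coe_iff.1 ((hf.pairing_le x y).trans_lt h)
    rw [map_sub]
    linarith

/-- Convexity at the midpoint, where `f` still dominates the pairing; `r = s = 0` is monotonicity.
-/
theorem neg_pairing_le {x x' : X} {y y' : Y} {r s : ℝ}
    (h : f (x, y) ≤ ((j y x + r : ℝ) : EReal)) (h' : f (x', y') ≤ ((j y' x' + s : ℝ) : EReal)) :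
    -(2 * r + 2 * s) ≤ j (y - y') (x - x') := by
  have := hf.pclsc.convex_coe h h' (a := 1 / 2) (b := 1 / 2) (by norm_num) (by norm_num)
    (by norm_num)
  have := EReal.coe_le_coe_iff.1 ((hf.pairing_le _ _).trans this)
  simp only [Prod.smul_fst, Prod.smul_snd, map_add, map_smul, add_apply, smul_apply,
    smul_eq_mul, map_sub, sub_apply] at this ⊢
  linarith

/-- With `C = {y}` the support term makes the penalty `j (y' - y) (x' - x)` plus half squares;
`neg_pairing_le` bounds that pairing below by a multiple of `-δ`. -/
theorem exists_approx_singleton {x : X} {y : Y} {δ : ℝ} (hδ : 0 < δ)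
    (h : f (x, y) ≤ ((j y x + δ : ℝ) : EReal)) :
    ∃ x' y', f (x', y') ≤ ((j y' x' + δ / 4 : ℝ) : EReal) ∧
      ‖x' - x‖ ≤ 4 * √δ ∧ ‖y' - y‖ ≤ 4 * √δ := by
  obtain ⟨x', y', c, hc, h1, h2⟩ := hf.exists_approx (singleton_nonempty y)
    (convex_singleton y) (by simp) (R := ‖y‖) (by simp) x (by positivity : 0 < δ / 4)
  obtain rfl : c = y := hc
  have h3 := hf.neg_pairing_le h1 h
  simp only [supportFun, image_singleton, csSup_singleton] at h2
  simp only [map_sub, sub_apply] at h2 h3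
  have h4 := Real.sq_sqrt hδ.le
  refine ⟨x', y', h1, abs_le_of_sq_le_sq' ?_ (by positivity) |>.2,
    abs_le_of_sq_le_sq' ?_ (by positivity) |>.2⟩ <;>
  nlinarith [sq_nonneg ‖x' - x‖, sq_nonneg ‖y' - c‖]

theorem eq_of_forall_exists {x : X} {y : Y}
    (h : ∀ ε > 0, ∃ x' y', f (x', y') ≤ ((j y' x' + ε : ℝ) : EReal) ∧
      ‖x' - x‖ ≤ ε ∧ ‖y' - y‖ ≤ ε) : f (x, y) = ((j y x : ℝ) : EReal) := by
  refine le_antisymm (not_lt.1 fun hlt => ?_) (hf.pairing_le x y)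
  obtain ⟨m, hm, hm'⟩ := EReal.lt_iff_exists_real_btwn.1 hlt
  rw [EReal.coe_lt_coe_iff] at hm
  have hcont : Continuous fun p : ℝ × X × Y => j p.2.2 p.2.1 + p.1 :=
    ((j.continuous.comp (continuous_snd.comp continuous_snd)).clm_apply
      (continuous_fst.comp continuous_snd)).add continuous_fst
  have h1 : ∀ᶠ p : ℝ × X × Y in 𝓝 (0, x, y), j p.2.2 p.2.1 + p.1 < m :=
    hcont.continuousAt.eventually_lt continuousAt_const (by simpa using hm)
  have h2 : ∀ᶠ p : ℝ × X × Y in 𝓝 (0, x, y), (m : EReal) < f p.2 :=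
    (continuous_snd.tendsto ((0 : ℝ), x, y)).eventually (hf.pclsc.lsc (x, y) m hm')
  obtain ⟨ε, hε, hb⟩ := Metric.eventually_nhds_iff.1 (h1.and h2)
  obtain ⟨x', y', h3, h4, h5⟩ := h (ε / 2) (by positivity)
  obtain ⟨h6, h7⟩ := @hb (ε / 2, x', y') (by
    rw [Prod.dist_eq, Prod.dist_eq, Real.dist_eq, dist_eq_norm, dist_eq_norm, sub_zero,
      abs_of_pos (half_pos hε)]
    exact max_lt (by linarith) (max_lt (by dsimp; linarith) (by dsimp; linarith)))
  exact absurd (EReal.coe_lt_coe_iff.1 (h7.trans_le h3)) (not_lt.2 h6.le)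

/-- Each step quarters the error and so halves the step length; the geometric series sums to `8 *
√δ`, and lower semicontinuity handles the limit. -/
theorem exists_eq_of_le [CompleteSpace X] [CompleteSpace Y] {x : X} {y : Y} {δ : ℝ} (hδ : 0 < δ)
    (h : f (x, y) ≤ ((j y x + δ : ℝ) : EReal)) :
    ∃ x' y', f (x', y') = ((j y' x' : ℝ) : EReal) ∧
      ‖x' - x‖ ≤ 8 * √δ ∧ ‖y' - y‖ ≤ 8 * √δ := by
  have step : ∀ (n : ℕ) (b : X × Y), ∃ b' : X × Y,
      f b ≤ ((j b.2 b.1 + δ / 4 ^ n : ℝ) : EReal) →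
        f b' ≤ ((j b'.2 b'.1 + δ / 4 ^ (n + 1) : ℝ) : EReal) ∧
          dist b b' ≤ 4 * √δ * (1 / 2) ^ n := by
    intro n b
    by_cases hb : f b ≤ ((j b.2 b.1 + δ / 4 ^ n : ℝ) : EReal)
    · obtain ⟨x', y', h1, h2, h3⟩ := hf.exists_approx_singleton (by positivity) hb
      have e : √(δ / 4 ^ n) = √δ * (1 / 2) ^ n := by
        rw [Real.sqrt_div hδ.le, show (4 : ℝ) ^ n = (2 ^ n) ^ 2 by
            rw [← pow_mul, mul_comm, pow_mul]; norm_num,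
          Real.sqrt_sq (by positivity), one_div, inv_pow, div_eq_mul_inv]
      rw [e, ← mul_assoc] at h2 h3
      refine ⟨(x', y'), fun _ => ⟨?_, ?_⟩⟩
      · rwa [pow_succ, ← div_div]
      · rw [dist_comm, Prod.dist_eq, dist_eq_norm, dist_eq_norm]
        exact max_le h2 h3
    · exact ⟨b, fun h => absurd h hb⟩
  choose g hg using step
  let b : ℕ → X × Y := fun n => Nat.rec (x, y) (fun n b => g n b) n
  have hb : ∀ n, f (b n) ≤ ((j (b n).2 (b n).1 + δ / 4 ^ n : ℝ) : EReal) := by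
    intro n
    induction n with
    | zero => simpa [b] using h
    | succ n ih => exact (hg n (b n) ih).1
  have hd : ∀ n, dist (b n) (b (n + 1)) ≤ 4 * √δ * (1 / 2) ^ n := fun n => (hg n (b n) (hb n)).2
  obtain ⟨p, hp⟩ := cauchySeq_tendsto_of_complete
    (cauchySeq_of_le_geometric (1 / 2) (4 * √δ) (by norm_num) hd)
  have hdist := dist_le_of_le_geometric_of_tendsto₀ (1 / 2) (4 * √δ) (by norm_num) hd hp
  have hδ0 : Tendsto (fun n : ℕ => δ / 4 ^ n) atTop (𝓝 0) :=
    tendsto_const_nhds.div_atTop (tendsto_pow_atTop_atTop_of_one_lt (by norm_num))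
  rw [dist_comm, Prod.dist_eq, show b 0 = (x, y) from rfl, dist_eq_norm, dist_eq_norm,
    show 4 * √δ / (1 - 1 / 2) = 8 * √δ by ring, max_le_iff] at hdist
  refine ⟨p.1, p.2, hf.eq_of_forall_exists fun ε hε => ?_, hdist.1, hdist.2⟩
  obtain ⟨n, h1, h2⟩ := ((hδ0.eventually (Iio_mem_nhds hε)).and
    (hp.eventually (Metric.ball_mem_nhds p hε))).exists
  rw [Prod.dist_eq, dist_eq_norm, dist_eq_norm, max_lt_iff] at h2
  refine ⟨(b n).1, (b n).2, (hb n).trans (EReal.coe_le_coe_iff.2 ?_), h2.1.le, h2.2.le⟩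
  have : δ / 4 ^ n < ε := h1
  linarith

theorem exists_mem_near [CompleteSpace X] [CompleteSpace Y] (hne : C.Nonempty)
    (hconv : Convex ℝ C) (hK : IsCompact ((fun c => StrongDual.toWeakDual (j c)) '' C)) {x₀ : X}
    (hS : ∀ s t, f (s, t) = ((j t s : ℝ) : EReal) → ∃ c ∈ C, 0 ≤ j (t - c) (s - x₀))
    {ε : ℝ} (hε : 0 < ε) :
    ∃ s t, f (s, t) = ((j t s : ℝ) : EReal) ∧ ‖s - x₀‖ ≤ ε ∧ ∃ c ∈ C, ‖t - c‖ ≤ ε := by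
  obtain ⟨R, hR⟩ := bounded_of_isCompact_toWeakDual hK
  have hR0 : 0 ≤ R := by
    obtain ⟨c, hc⟩ := hne
    exact (norm_nonneg c).trans (hR c hc)
  obtain ⟨r, hr, hr1, hr2, hr3⟩ : ∃ r > 0, r ≤ 1 ∧ r ≤ ε / 2 ∧ r * (2 * R + 4) ≤ ε ^ 2 / 16 := by
    refine ⟨min 1 (min (ε / 2) (ε ^ 2 / 16 / (2 * R + 4))), by positivity, min_le_left _ _,
      (min_le_right _ _).trans (min_le_left _ _), ?_⟩
    rw [← le_div_iff₀ (by positivity)]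
    exact (min_le_right _ _).trans (min_le_right _ _)
  obtain ⟨x, y, c, hc, h1, h2⟩ := hf.exists_approx hne hconv hK hR x₀
    (by positivity : 0 < (r / 8) ^ 2)
  obtain ⟨s, t, hst, h3, h4⟩ := hf.exists_eq_of_le (by positivity) h1
  rw [Real.sqrt_sq (by positivity), show 8 * (r / 8) = r by ring] at h3 h4
  -- This makes support term plus pairing nonnegative at `(s, t)`, hence at least `-O(r)` at `(x,
  -- y)`, so the half squares are small.
  obtain ⟨c', hc', h5⟩ := hS s t hst
  have h6 := le_supportFun (j := j) hR hc' (x₀ - s)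
  have h7 := supportFun_le_add (j := j) hne hR (x₀ - s) (x₀ - x)
  rw [show x₀ - s - (x₀ - x) = -(s - x) by abel, norm_neg] at h7
  have bound : ∀ (y : Y) (x : X), j y x ≤ ‖y‖ * ‖x‖ := fun y x => by
    have := (le_abs_self _).trans ((j y).le_opNorm x)
    rwa [j.norm_map] at this
  have h8 := bound y (s - x)
  have h9 := bound (t - y) (s - x₀)
  have h10 : ‖y‖ ≤ R + ‖y - c‖ := by
    have := norm_le_insert' y c
    linarith [hR c hc]
  have h11 : ‖s - x₀‖ ≤ r + ‖x - x₀‖ := by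
    have := norm_add_le (s - x) (x - x₀)
    rw [sub_add_sub_cancel] at this
    linarith
  have h12 : ‖t - c‖ ≤ r + ‖y - c‖ := by
    have := norm_add_le (t - y) (y - c)
    rw [sub_add_sub_cancel] at this
    linarith
  have h13 : ‖y‖ * ‖s - x‖ ≤ (R + ‖y - c‖) * r :=
    mul_le_mul h10 h3 (norm_nonneg _) (by positivity)
  have h14 : ‖t - y‖ * ‖s - x₀‖ ≤ r * (r + ‖x - x₀‖) :=
    mul_le_mul h4 h11 (norm_nonneg _) hr.le
  have h15 : R * ‖s - x‖ ≤ R * r := mul_le_mul_of_nonneg_left h3 hR0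
  simp only [map_sub, sub_apply] at h2 h5 h6 h8 h9
  have h16 : ‖x - x₀‖ ^ 2 / 4 + ‖y - c‖ ^ 2 / 4 ≤ ε ^ 2 / 16 := by
    nlinarith [sq_nonneg (‖x - x₀‖ - 2 * r), sq_nonneg (‖y - c‖ - 2 * r)]
  have h17 : ‖x - x₀‖ ≤ ε / 2 :=
    (abs_le_of_sq_le_sq' (by nlinarith [sq_nonneg ‖y - c‖]) (by positivity)).2
  have h18 : ‖y - c‖ ≤ ε / 2 :=
    (abs_le_of_sq_le_sq' (by nlinarith [sq_nonneg ‖x - x₀‖]) (by positivity)).2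
  exact ⟨s, t, hst, by linarith, c, hc, by linarith⟩

theorem eq_of_forall_nonneg [CompleteSpace X] [CompleteSpace Y] {x : X} {y : Y}
    (h : ∀ s t, f (s, t) = ((j t s : ℝ) : EReal) → 0 ≤ j (t - y) (s - x)) :
    f (x, y) = ((j y x : ℝ) : EReal) := by
  refine hf.eq_of_forall_exists fun ε hε => ?_
  obtain ⟨s, t, h1, h2, c, rfl, h3⟩ := hf.exists_mem_near (singleton_nonempty y)
    (convex_singleton y) (by simp) (fun s t hst => ⟨y, rfl, h s t hst⟩) hε
  exact ⟨s, t, h1.le.trans (EReal.coe_le_coe_iff.2 (by linarith)), h2, h3⟩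

theorem exists_mem_eq [CompleteSpace X] [CompleteSpace Y] (hne : C.Nonempty)
    (hconv : Convex ℝ C) (hK : IsCompact ((fun c => StrongDual.toWeakDual (j c)) '' C)) {x₀ : X}
    (hS : ∀ s t, f (s, t) = ((j t s : ℝ) : EReal) → ∃ c ∈ C, 0 ≤ j (t - c) (s - x₀)) :
    ∃ c ∈ C, f (x₀, c) = ((j c x₀ : ℝ) : EReal) := by
  obtain ⟨R, hR⟩ := bounded_of_isCompact_toWeakDual hK
  let ε : ℕ → ℝ := fun n => 1 / ((n : ℝ) + 1)
  have hε0 : Tendsto ε atTop (𝓝 0) := tendsto_one_div_add_atTop_nhds_zero_nat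
  choose s t hst hs c hc ht using fun n : ℕ =>
    hf.exists_mem_near hne hconv hK hS (Nat.one_div_pos_of_nat (α := ℝ) (n := n))
  -- Weak* compactness need not be sequential, so the limit is taken along an ultrafilter.
  let U : Ultrafilter ℕ := Filter.hyperfilter ℕ
  obtain ⟨_, ⟨c₀, hc₀, rfl⟩, hU⟩ := hK.ultrafilter_le_nhds'
    (U.map fun n => StrongDual.toWeakDual (j (c n)))
    (Ultrafilter.mem_map.2 (Filter.univ_mem' fun n => ⟨c n, hc n, rfl⟩))
  have hlim : ∀ z, Tendsto (fun n => j (c n) z) U (𝓝 (j c₀ z)) := fun z =>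
    ((WeakDual.eval_continuous (𝕜 := ℝ) z).tendsto _).comp hU
  refine ⟨c₀, hc₀, hf.eq_of_forall_nonneg fun p q hpq => ?_⟩
  have hUle : (U : Filter ℕ) ≤ atTop := Nat.hyperfilter_le_atTop
  -- The vanishing second term offsets the error of replacing `(s n, t n)` by `(x₀, c n)` in the
  -- monotonicity inequality.
  have h1 : Tendsto (fun n => j (q - c n) (p - x₀) +
      ε n * (‖p - x₀‖ + ε n + ‖q‖ + R)) U (𝓝 (j (q - c₀) (p - x₀))) := by
    have h2 : Tendsto (fun n => ε n * (‖p - x₀‖ + ε n + ‖q‖ + R)) U (𝓝 0) := by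
      have := hε0.mul (((hε0.const_add ‖p - x₀‖).add_const ‖q‖).add_const R)
      rw [zero_mul] at this
      exact this.mono_left hUle
    have h3 := ((hlim (p - x₀)).const_sub (j q (p - x₀))).add h2
    have h4 : ∀ y, j (q - y) (p - x₀) = j q (p - x₀) - j y (p - x₀) := fun y => by
      rw [map_sub j, sub_apply]
    simpa only [h4, add_zero] using h3
  refine ge_of_tendsto h1 (Filter.Eventually.of_forall fun n => ?_)
  have bound : ∀ (y : Y) (x : X), j y x ≤ ‖y‖ * ‖x‖ := fun y x => by
    have := (le_abs_self _).trans ((j y).le_opNorm x)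
    rwa [j.norm_map] at this
  have e : ε n = 1 / ((n : ℝ) + 1) := rfl
  have hsn := hs n
  have htn := ht n
  rw [← e] at hsn htn
  have hε : 0 < ε n := by rw [e]; positivity
  have h4 := hf.neg_pairing_le (r := 0) (s := 0) (by rw [add_zero]; exact hpq.le)
    (by rw [add_zero]; exact (hst n).le)
  have h5 := bound (c n - t n) (p - s n)
  have h6 := bound (q - c n) (x₀ - s n)
  have h7 : ‖p - s n‖ ≤ ‖p - x₀‖ + ε n := by
    have := norm_add_le (p - x₀) (x₀ - s n)
    rw [sub_add_sub_cancel, norm_sub_rev x₀] at this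
    linarith
  have h8 : ‖q - c n‖ ≤ ‖q‖ + R := (norm_sub_le _ _).trans (by linarith [hR _ (hc n)])
  rw [norm_sub_rev] at h5
  rw [norm_sub_rev x₀] at h6
  have h9 := mul_le_mul htn h7 (norm_nonneg _) hε.le
  have h10 := mul_le_mul h8 hsn (norm_nonneg _) ((norm_nonneg _).trans h8)
  simp only [map_sub, sub_apply] at h4 h5 h6 ⊢
  linarith

end IsDualRepresentative

end Duality

/-! ### The two instances: `f` and its transpose -/

section Applications

variable {E : Type*} [NormedAddCommGroup E] [NormedSpace ℝ E] {f : E × StrongDual ℝ E → EReal}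

theorem IsPCLSC.comp_swap {X Y : Type*} [NormedAddCommGroup X] [NormedSpace ℝ X]
    [NormedAddCommGroup Y] [NormedSpace ℝ Y] {f : X × Y → EReal} (hf : IsPCLSC f) :
    IsPCLSC (f ∘ Prod.swap) where
  ne_bot x := hf.ne_bot _
  exists_ne_top := by
    obtain ⟨x, hx⟩ := hf.exists_ne_top
    exact ⟨x.swap, by simpa using hx⟩
  convex x y a b ha hb hab := hf.convex x.swap y.swap a b ha hb hab
  lsc := hf.lsc.comp continuous_swap

theorem fenchelConj_comp_swap {X Y : Type*} [NormedAddCommGroup X] [NormedSpace ℝ X]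
    [NormedAddCommGroup Y] [NormedSpace ℝ Y] (f : X × Y → EReal) (u : StrongDual ℝ X)
    (v : StrongDual ℝ Y) : fenchelConj (f ∘ Prod.swap) (v.coprod u) = fenchelConj f (u.coprod v) :=
  (Equiv.prodComm Y X).iSup_congr fun p => by simp [add_comm]

theorem IsStronglyRepresentative.isDualRepresentative (hf : IsStronglyRepresentative f) :
    IsDualRepresentative (LinearIsometry.id : StrongDual ℝ E →ₗᵢ[ℝ] StrongDual ℝ E)
      (ContinuousLinearMap.id ℝ (StrongDual ℝ (StrongDual ℝ E))).flip f where
  pclsc := hf.representative.pclsc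
  pairing_le := hf.representative.pairing_le
  pairing_le_conj := hf.pairing_le_conj
  apply_left _ _ := rfl
  apply_right _ _ := rfl
  norm_le u v := (v.le_opNorm u).trans_eq (mul_comm _ _)

theorem IsStronglyRepresentative.isDualRepresentative_swap (hf : IsStronglyRepresentative f) :
    IsDualRepresentative (NormedSpace.inclusionInDoubleDualLi (E := E) ℝ)
      (ContinuousLinearMap.id ℝ (StrongDual ℝ (StrongDual ℝ E))) (f ∘ Prod.swap) where
  pclsc := hf.representative.pclsc.comp_swap
  pairing_le xs x := hf.representative.pairing_le x xs
  pairing_le_conj u v := (hf.pairing_le_conj v u).trans_eq (fenchelConj_comp_swap f v u).symm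
  apply_left _ _ := rfl
  apply_right _ _ := rfl
  norm_le u v := u.le_opNorm v

theorem IsStronglyRepresentative.isMonotone (hf : IsStronglyRepresentative f) :
    IsMonotone (multifunctionOf f) := by
  intro s t ss hs ts ht
  have := hf.isDualRepresentative.neg_pairing_le (r := 0) (s := 0) (x := s) (x' := t) (y := ss)
    (y' := ts) (by rw [add_zero]; exact hs.le) (by rw [add_zero]; exact ht.le)
  simpa using this

/-- The canonical embedding is continuous from the weak topology of `E` to the weak* topology of
`E**`. -/
theorem isCompact_image_inclusionInDoubleDual {C : Set E}
    (hC : IsCompact (toWeakSpace ℝ E '' C : Set (WeakSpace ℝ E))) :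
    IsCompact ((fun c => StrongDual.toWeakDual
      (NormedSpace.inclusionInDoubleDualLi (E := E) ℝ c)) '' C) := by
  have := hC.image (NormedSpace.inclusionInDoubleDualWeak ℝ E).continuous
  rwa [image_image] at this

end Applications

end StronglyRepresentable

theorem theorem17 {E : Type*} [NormedAddCommGroup E] [NormedSpace ℝ E] [CompleteSpace E]
    (S : E → Set (StrongDual ℝ E)) (hS : StronglyRepresentable.IsStronglyRepresentable S) :
    StronglyRepresentable.IsStronglyMaximallyMonotone S := by
  obtain ⟨f, hf, rfl⟩ := hS
  refine ⟨⟨hf.isMonotone, fun y C hne hK hconv h => ?_⟩,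
    ⟨hf.isMonotone, fun C ys hne hK hconv h => ?_⟩⟩
  · obtain ⟨c, hc, hfc⟩ := hf.isDualRepresentative.exists_mem_eq hne hconv hK
      (fun s t hst => h s t hst)
    exact ⟨c, hfc, hc⟩
  · obtain ⟨c, hc, hfc⟩ := hf.isDualRepresentative_swap.exists_mem_eq hne hconv
      (StronglyRepresentable.isCompact_image_inclusionInDoubleDual hK)
      (fun t s hst => h s t hst)
    exact ⟨c, hfc, hc⟩
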